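/- There exist functions $f,g:\mathbb N\to\mathbb N$ with the following property. For a group $H$, let $Z_0(H)=1$, let $Z_{\alpha+1}(H)/Z_\alpha(H)$ be the center of $H/Z_\alpha(H)$ for every ordinal $\alpha$, and let $Z_\lambda(H)=\bigcup_{\alpha<\lambda}Z_\alpha(H)$ for limit ordinals $\lambda$; the hypercenter $Z_\infty(H)$ is the last term (the union) of this ascending series, and $H$ is called hypercentral if $H=Z_\infty(H)$. Let $G$ be a group with a finite series $$G=G_0\ge F_1\ge G_1\ge\dots\ge F_n\ge G_n=1$$ of normal subgroups of $G$ such that, for each $i=1,\dots,n$, the factor $F_i/G_i$ is finite of order $t_i>1$ and $G_{i-1}/F_i\le Z_\infty(G/F_i)$. Put $t=t_1\cdots t_n$. Then $G$ has a finite normal subgroup $L$ with $|L|\le f(t)$ such that $G/L$ is hypercentral. Moreover, $Z_\infty(G)$ has finite index in $G$, and $|G:Z_\infty(G)|\le g(t)$. -/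

import Mathlib

universe u

/-- The transfinite upper central series, bundled with the normality of its terms:
`Z_0 = 1`, `Z_{α+1}` is the preimage in `G` of the centre of `G / Z_α`, and at a limit ordinal the
supremum (by `mem_transfiniteCenter_limit`, the union) of the earlier terms is taken. -/
noncomputable def transfiniteCenterAux (G : Type u) [Group G] (α : Ordinal.{u}) :
    {N : Subgroup G // N.Normal} :=
  Ordinal.limitRecOn α
    ⟨⊥, inferInstance⟩
    (fun _ N =>
      haveI := N.2
      ⟨(Subgroup.center (G ⧸ N.1)).comap (QuotientGroup.mk' N.1), inferInstance⟩)
    (fun l _ Z =>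
      ⟨⨆ β : Set.Iio l, (Z β.1 β.2).1, haveI := fun β : Set.Iio l => (Z β.1 β.2).2; inferInstance⟩)

/-- The `α`-th centre `Z_α(G)` of `G`, for an ordinal `α`. -/
noncomputable def transfiniteCenter (G : Type u) [Group G] (α : Ordinal.{u}) : Subgroup G :=
  (transfiniteCenterAux G α).1

instance transfiniteCenter_normal (G : Type u) [Group G] (α : Ordinal.{u}) :
    (transfiniteCenter G α).Normal :=
  (transfiniteCenterAux G α).2

/-- The hypercenter `Z_∞(G)`: the last term of the transfinite upper central series, that is, the
union of all its terms (see `exists_transfiniteCenter_eq_hypercenter`). -/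
noncomputable def hypercenter (G : Type u) [Group G] : Subgroup G :=
  ⨆ α : Ordinal.{u}, transfiniteCenter G α

/-- A group is hypercentral if it coincides with its hypercenter. -/
def IsHypercentral (G : Type u) [Group G] : Prop :=
  hypercenter G = ⊤

theorem transfiniteCenter_zero (G : Type u) [Group G] : transfiniteCenter G 0 = ⊥ := by
  simp [transfiniteCenter, transfiniteCenterAux]

theorem transfiniteCenter_succ (G : Type u) [Group G] (α : Ordinal.{u}) :
    transfiniteCenter G (α + 1) =
      (Subgroup.center (G ⧸ transfiniteCenter G α)).comap
        (QuotientGroup.mk' (transfiniteCenter G α)) := by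
  have h : transfiniteCenterAux G (α + 1) = _ := Ordinal.limitRecOn_add_one α _ _ _
  exact congrArg Subtype.val h

theorem transfiniteCenter_limit (G : Type u) [Group G] {l : Ordinal.{u}}
    (hl : Order.IsSuccLimit l) :
    transfiniteCenter G l = ⨆ β : Set.Iio l, transfiniteCenter G β.1 := by
  have h : transfiniteCenterAux G l = _ := Ordinal.limitRecOn_limit l _ _ _ hl
  exact congrArg Subtype.val h

theorem transfiniteCenter_mono (G : Type u) [Group G] : Monotone (transfiniteCenter G) := by
  intro α β
  induction β using Ordinal.limitRecOn with
  | zero =>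
    intro h
    rw [show α = 0 by simpa using h]
  | add_one β ih =>
    intro h
    rcases h.eq_or_lt with rfl | h
    · exact le_rfl
    refine (ih (Order.lt_add_one_iff.mp h)).trans ?_
    rw [transfiniteCenter_succ]
    intro x hx
    rw [Subgroup.mem_comap, QuotientGroup.mk'_apply, (QuotientGroup.eq_one_iff x).mpr hx]
    exact one_mem _
  | limit l hl ih =>
    intro h
    rcases h.eq_or_lt with rfl | h
    · exact le_rfl
    rw [transfiniteCenter_limit G hl]
    exact le_iSup (fun β : Set.Iio l => transfiniteCenter G β.1) ⟨α, h⟩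

theorem mem_transfiniteCenter_limit (G : Type u) [Group G] {l : Ordinal.{u}}
    (hl : Order.IsSuccLimit l) (x : G) :
    x ∈ transfiniteCenter G l ↔ ∃ β < l, x ∈ transfiniteCenter G β := by
  have : Nonempty (Set.Iio l) := ⟨⟨0, hl.bot_lt⟩⟩
  rw [transfiniteCenter_limit G hl, Subgroup.mem_iSup_of_directed]
  · simp
  · exact Monotone.directed_le fun a b h => transfiniteCenter_mono G h

theorem exists_transfiniteCenter_eq_hypercenter (G : Type u) [Group G] :
    ∃ α : Ordinal.{u}, transfiniteCenter G α = hypercenter G := by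
  have hmem (x : G) : x ∈ hypercenter G ↔ ∃ α, x ∈ transfiniteCenter G α :=
    Subgroup.mem_iSup_of_directed (transfiniteCenter_mono G).directed_le
  choose a ha using fun x : hypercenter G => (hmem x).mp x.2
  refine ⟨⨆ x, a x, le_antisymm (le_iSup (transfiniteCenter G) _) fun x hx => ?_⟩
  exact transfiniteCenter_mono G (Ordinal.le_iSup a ⟨x, hx⟩) (ha ⟨x, hx⟩)

/-!
Two bounds are combined. If `L` is finite and normal and `G ⧸ L` is hypercentral, then the
hypercenter of `G` has finite index: the quotient of `G` by its hypercenter has trivial center, and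
in a group with trivial center the centralizer of such an `L` is contained in `L`, so that the order
of the group is bounded in terms of `|L|`. Conversely, let the hypercenter `Z` of `G` have finite
index and let `F` be a finitely generated subgroup with `F Z = G`. Then `F ∩ Z` lies in a finite
term of the upper central series of `F`, so by Baer's theorem some term of the lower central series
of `F` is finite. The term `R` at which that series becomes stationary is centralized by `Z`, hence
normal in `G`, and `G ⧸ R` is hypercentral. Since `R = [R, G]` and `G` acts on `R / R'` as a
hypercentral group, this action has no nontrivial fixed points, whence `R ∩ Z ≤ R'`; this bounds
`|R : R'|`, and Schur's theorem bounds `|R'|`.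

Going down the series, suppose that `G` has a normal subgroup which is finite modulo `G_{i-1}` and
whose quotient is hypercentral. The first bound, applied to `G ⧸ G_{i-1}`, shows that the
hypercenter of `G ⧸ F_i` has finite index, and the second one yields a subgroup of the same kind
for `G_i`.
-/

namespace Hypercentral

open Subgroup QuotientGroup
open scoped commutatorElement

section Hypercenter

variable {G : Type u} [Group G]

theorem mem_transfiniteCenter_succ {α : Ordinal.{u}} {x : G} :
    x ∈ transfiniteCenter G (α + 1) ↔ ∀ g : G, ⁅x, g⁆ ∈ transfiniteCenter G α := by
  rw [transfiniteCenter_succ, ← Subgroup.upperCentralSeriesStep_eq_comap_center,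
    Subgroup.mem_upperCentralSeriesStep]

theorem mem_hypercenter_iff {x : G} :
    x ∈ hypercenter G ↔ ∃ α : Ordinal.{u}, x ∈ transfiniteCenter G α :=
  mem_iSup_of_directed (transfiniteCenter_mono G).directed_le

instance hypercenter_normal : (hypercenter G).Normal := by
  obtain ⟨α, hα⟩ := exists_transfiniteCenter_eq_hypercenter G
  exact hα ▸ inferInstance

theorem mem_hypercenter_of_commutator_mem {x : G} (hx : ∀ g : G, ⁅x, g⁆ ∈ hypercenter G) :
    x ∈ hypercenter G := by
  obtain ⟨α, hα⟩ := exists_transfiniteCenter_eq_hypercenter G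
  rw [← hα] at hx
  exact mem_hypercenter_iff.2 ⟨α + 1, mem_transfiniteCenter_succ.2 hx⟩

theorem hypercenter_induction {p : G → Prop} (one : p 1)
    (commutator : ∀ x, (∀ g : G, p ⁅x, g⁆) → p x) {x : G} (hx : x ∈ hypercenter G) : p x := by
  obtain ⟨α, hα⟩ := mem_hypercenter_iff.1 hx
  clear hx
  induction α using Ordinal.limitRecOn generalizing x with
  | zero =>
    rw [transfiniteCenter_zero, mem_bot] at hα
    exact hα ▸ one
  | add_one α ih => exact commutator x fun g => ih (mem_transfiniteCenter_succ.1 hα g)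
  | limit l hl ih =>
    obtain ⟨β, hβ, hx⟩ := (mem_transfiniteCenter_limit G hl x).1 hα
    exact ih β hβ hx

end Hypercenter

section HypercenterOver

variable {G : Type u} [Group G] {A B K V : Subgroup G}

theorem commutatorElement_mem_left [V.Normal] {x : G} (hx : x ∈ V) (g : G) : ⁅x, g⁆ ∈ V :=
  commutator_le_left V ⊤ (commutator_mem_commutator hx (mem_top g))

theorem mk_commutatorElement (A : Subgroup G) [A.Normal] (x g : G) :
    ((⁅x, g⁆ : G) : G ⧸ A) = ⁅(x : G ⧸ A), (g : G ⧸ A)⁆ :=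
  map_commutatorElement (mk' A) x g

/-- The preimage in `G` of the hypercenter of `G ⧸ A`, so that the factors which are hypercentral
modulo `A` are the subgroups between `A` and `hypercenterOver A`. -/
noncomputable def hypercenterOver (A : Subgroup G) [A.Normal] : Subgroup G :=
  (hypercenter (G ⧸ A)).comap (mk' A)

instance hypercenterOver_normal [A.Normal] : (hypercenterOver A).Normal :=
  inferInstanceAs ((hypercenter (G ⧸ A)).comap (mk' A)).Normal

theorem le_hypercenterOver [A.Normal] : A ≤ hypercenterOver A := by
  intro x hx
  rw [hypercenterOver, mem_comap, mk'_apply, (QuotientGroup.eq_one_iff x).2 hx]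
  exact one_mem _

theorem mem_hypercenterOver_of_commutator_mem [A.Normal] {x : G}
    (hx : ∀ g : G, ⁅x, g⁆ ∈ hypercenterOver A) : x ∈ hypercenterOver A := by
  refine mem_hypercenter_of_commutator_mem fun g => ?_
  obtain ⟨g, rfl⟩ := mk'_surjective A g
  rw [← map_commutatorElement]
  exact hx g

theorem hypercenterOver_induction [A.Normal] {p : G → Prop} (mem : ∀ a ∈ A, p a)
    (commutator : ∀ x, (∀ g : G, p ⁅x, g⁆) → p x) {x : G} (hx : x ∈ hypercenterOver A) : p x := by
  suffices h : ∀ y : G, (y : G ⧸ A) = x → p y from h x rfl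
  refine hypercenter_induction (p := fun q => ∀ y : G, (y : G ⧸ A) = q → p y)
    (fun y hy => mem y ((QuotientGroup.eq_one_iff y).1 hy)) ?_ hx
  rintro _ hq y rfl
  exact commutator y fun g => hq g _ (mk_commutatorElement A y g)

/-- No element of `V` outside `K` is central modulo `K`: the conjugation action of `G` on the
section `V / K` has no nontrivial fixed point. -/
def FixedPointFree (K V : Subgroup G) : Prop :=
  ∀ x ∈ V, (∀ g : G, ⁅x, g⁆ ∈ K) → x ∈ K

theorem FixedPointFree.inf_hypercenterOver_le [A.Normal] [V.Normal] (hKV : FixedPointFree K V)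
    (hAK : A ≤ K) : V ⊓ hypercenterOver A ≤ K := by
  rintro x ⟨hxV, hx⟩
  refine hypercenterOver_induction (p := fun x => x ∈ V → x ∈ K) (fun a ha _ => hAK ha) ?_ hx hxV
  exact fun x hx hxV => hKV x hxV fun g => hx g (commutatorElement_mem_left hxV g)

theorem FixedPointFree.hypercenterOver_le [A.Normal] (hK : FixedPointFree K ⊤) (hAK : A ≤ K) :
    hypercenterOver A ≤ K := by
  simpa only [top_inf_eq] using hK.inf_hypercenterOver_le hAK

theorem fixedPointFree_hypercenterOver [A.Normal] : FixedPointFree (hypercenterOver A) ⊤ :=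
  fun _ _ => mem_hypercenterOver_of_commutator_mem

theorem hypercenterOver_le_hypercenterOver [A.Normal] [B.Normal] (h : A ≤ hypercenterOver B) :
    hypercenterOver A ≤ hypercenterOver B :=
  fixedPointFree_hypercenterOver.hypercenterOver_le h

theorem hypercenterOver_mono [A.Normal] [B.Normal] (h : A ≤ B) :
    hypercenterOver A ≤ hypercenterOver B :=
  hypercenterOver_le_hypercenterOver (h.trans le_hypercenterOver)

theorem hypercenterOver_bot : hypercenterOver (⊥ : Subgroup G) = hypercenter G :=
  le_antisymm
    (FixedPointFree.hypercenterOver_le (fun _ _ => mem_hypercenter_of_commutator_mem) bot_le)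
    fun _ => hypercenter_induction (one_mem _) fun _ => mem_hypercenterOver_of_commutator_mem

theorem hypercenterOver_eq_top_iff [A.Normal] :
    hypercenterOver A = ⊤ ↔ IsHypercentral (G ⧸ A) := by
  rw [hypercenterOver, IsHypercentral, ← comap_top (mk' A),
    (comap_injective (mk'_surjective A)).eq_iff]

theorem comap_hypercenterOver_le {G' : Type*} [Group G'] (f : G' →* G) [A.Normal] :
    (hypercenterOver A).comap f ≤ hypercenterOver (A.comap f) := by
  intro x hx
  refine hypercenterOver_induction (p := fun y => ∀ x, f x = y → x ∈ hypercenterOver (A.comap f))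
    ?_ ?_ hx x rfl
  · rintro _ ha x rfl
    exact le_hypercenterOver (mem_comap.2 ha)
  · rintro _ h x rfl
    exact mem_hypercenterOver_of_commutator_mem fun g => h (f g) _ (map_commutatorElement f x g)

theorem hypercenterOver_map_eq_top {G' : Type*} [Group G'] {f : G →* G'}
    (hf : Function.Surjective f) [A.Normal] [(A.map f).Normal] (hA : hypercenterOver A = ⊤) :
    hypercenterOver (A.map f) = ⊤ := by
  have hfree : FixedPointFree ((hypercenterOver (A.map f)).comap f) ⊤ := fun x _ hx => by
    refine mem_hypercenterOver_of_commutator_mem fun g => ?_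
    obtain ⟨g, rfl⟩ := hf g
    exact map_commutatorElement f x g ▸ hx g
  have htop := hA.ge.trans (hfree.hypercenterOver_le (map_le_iff_le_comap.1 le_hypercenterOver))
  rw [eq_top_iff, ← map_top_of_surjective f hf]
  exact map_le_iff_le_comap.2 htop

end HypercenterOver

section SectionCentralizer

variable {G : Type u} [Group G] {A B N : Subgroup G}

theorem mem_of_mk_eq (hAB : A ≤ B) {x y : G} (hxy : (x : G ⧸ A) = y) (hx : x ∈ B) :
    y ∈ B := by
  simpa only [mul_inv_cancel_left] using B.mul_mem hx (hAB (QuotientGroup.eq.1 hxy))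

theorem commute_mk_iff [A.Normal] {x y : G} : Commute (x : G ⧸ A) (y : G ⧸ A) ↔ ⁅x, y⁆ ∈ A := by
  rw [← commutatorElement_eq_one_iff_commute, ← mk_commutatorElement, QuotientGroup.eq_one_iff]

/-- The elements of `G` acting trivially by conjugation on the section `N / A`, for `A ≤ N`. -/
def sectionCentralizer (A N : Subgroup G) [A.Normal] : Subgroup G :=
  (centralizer (N.map (mk' A))).comap (mk' A)

theorem mem_sectionCentralizer_iff [A.Normal] {g : G} :
    g ∈ sectionCentralizer A N ↔ ∀ v ∈ N, ⁅v, g⁆ ∈ A := by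
  rw [sectionCentralizer, mem_comap, mem_centralizer_iff, coe_map, Set.forall_mem_image]
  exact forall₂_congr fun v _ => commute_mk_iff

instance sectionCentralizer_normal [A.Normal] [N.Normal] : (sectionCentralizer A N).Normal :=
  haveI : (N.map (mk' A)).Normal := Normal.map ‹_› _ (mk'_surjective A)
  inferInstanceAs ((centralizer (N.map (mk' A) : Set (G ⧸ A))).comap (mk' A)).Normal

/-- The section `N / A` is abelian and `G` induces a hypercentral group of automorphisms on it. -/
structure IsHypercentralSection (A N : Subgroup G) [A.Normal] [N.Normal] : Prop where
  abelian : ⁅N, N⁆ ≤ A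
  hypercentral : hypercenterOver (sectionCentralizer A N) = ⊤

theorem IsHypercentralSection.of_commutator_le {C : Subgroup G} [A.Normal] [N.Normal] [C.Normal]
    (hNN : ⁅N, N⁆ ≤ A) (hNC : ⁅N, C⁆ ≤ A) (hC : hypercenterOver C = ⊤) :
    IsHypercentralSection A N where
  abelian := hNN
  hypercentral := top_le_iff.1 <| hC.ge.trans <| hypercenterOver_mono fun _ hc =>
    mem_sectionCentralizer_iff.2 fun _ hv => hNC (commutator_mem_commutator hv hc)

theorem IsHypercentralSection.mono_left [A.Normal] [B.Normal] [N.Normal]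
    (h : IsHypercentralSection A N) (hAB : A ≤ B) : IsHypercentralSection B N where
  abelian := h.abelian.trans hAB
  hypercentral := top_le_iff.1 <| h.hypercentral.ge.trans <| hypercenterOver_mono fun _ hg =>
    mem_sectionCentralizer_iff.2 fun v hv => hAB (mem_sectionCentralizer_iff.1 hg v hv)

theorem sectionCentralizer_anti_right [A.Normal] {M : Subgroup G} (hMN : M ≤ N) :
    sectionCentralizer A N ≤ sectionCentralizer A M := fun _ hg =>
  mem_sectionCentralizer_iff.2 fun v hv => mem_sectionCentralizer_iff.1 hg v (hMN hv)

theorem IsHypercentralSection.mono_right [A.Normal] [N.Normal] {M : Subgroup G} [M.Normal]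
    (h : IsHypercentralSection A N) (hMN : M ≤ N) : IsHypercentralSection A M where
  abelian := (commutator_mono hMN hMN).trans h.abelian
  hypercentral := top_le_iff.1 <| h.hypercentral.ge.trans <|
    hypercenterOver_mono (sectionCentralizer_anti_right hMN)

theorem IsHypercentralSection.exists_central_mod_sectionCentralizer [A.Normal] [N.Normal]
    (h : IsHypercentralSection A N) (hN : ¬ ⁅N, ⊤⁆ ≤ A) :
    ∃ z, (∀ g, ⁅z, g⁆ ∈ sectionCentralizer A N) ∧ ∃ v ∈ N, ⁅v, z⁆ ∉ A := by
  by_contra! hz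
  refine hN (commutator_le.2 fun v hv g _ => ?_)
  have hfree : FixedPointFree (sectionCentralizer A N) ⊤ := fun z _ hzC =>
    mem_sectionCentralizer_iff.2 (hz z hzC)
  have hg : g ∈ hypercenterOver (sectionCentralizer A N) := h.hypercentral ▸ mem_top g
  exact mem_sectionCentralizer_iff.1 (hfree.hypercenterOver_le le_rfl hg) v hv

end SectionCentralizer

section CommutatorHom

variable {G : Type u} [Group G] {A N : Subgroup G} [A.Normal] [N.Normal] {z : G}

/-- The homomorphism `v ↦ ⁅v, z⁆` from `N` to `G ⧸ A`, when the section `N / A` is abelian. -/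
def commutatorHom (hN : ⁅N, N⁆ ≤ A) (z : G) : N →* G ⧸ A :=
  MonoidHom.mk' (fun v => ((⁅(v : G), z⁆ : G) : G ⧸ A)) fun v w => by
    have hcomm {x y : G} (hx : x ∈ N) (hy : y ∈ N) : Commute (x : G ⧸ A) (y : G ⧸ A) :=
      commute_mk_iff.2 (hN (commutator_mem_commutator hx hy))
    have hvz : ⁅(v : G), z⁆ ∈ N := commutatorElement_mem_left v.2 z
    have hwz : ⁅(w : G), z⁆ ∈ N := commutatorElement_mem_left w.2 z
    rw [coe_mul, commutatorElement_mul_left_eq_conj_mul, QuotientGroup.mk_mul,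
      QuotientGroup.mk_mul, QuotientGroup.mk_mul, QuotientGroup.mk_inv,
      (hcomm v.2 hwz).eq, mul_inv_cancel_right, (hcomm hwz hvz).eq]

theorem commutatorHom_apply (hN : ⁅N, N⁆ ≤ A) (v : N) :
    commutatorHom hN z v = ((⁅(v : G), z⁆ : G) : G ⧸ A) :=
  rfl

theorem mk_commutator_conj (hz : ∀ g, ⁅z, g⁆ ∈ sectionCentralizer A N) (g : G) {v : G}
    (hv : v ∈ N) : ((⁅g * v * g⁻¹, z⁆ : G) : G ⧸ A) = ((g * ⁅v, z⁆ * g⁻¹ : G) : G ⧸ A) := by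
  have hconj : g * z * g⁻¹ = ⁅g, z⁆ * z := by rw [commutatorElement_def, inv_mul_cancel_right]
  have hgz : ⁅g, z⁆ ∈ sectionCentralizer A N := by
    rw [← commutatorElement_inv]
    exact inv_mem (hz g)
  have hw : g * v * g⁻¹ ∈ N := Normal.conj_mem ‹_› v hv g
  have htriv := mem_sectionCentralizer_iff.1 hgz
  have hcomm : Commute ((⁅g * v * g⁻¹, z⁆ : G) : G ⧸ A) ((⁅g, z⁆ : G) : G ⧸ A) :=
    commute_mk_iff.2 (htriv _ (commutatorElement_mem_left hw z))
  rw [conjugate_commutatorElement, hconj, commutatorElement_mul_right_eq_mul_conj,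
    QuotientGroup.mk_mul, QuotientGroup.mk_mul, QuotientGroup.mk_mul,
    (QuotientGroup.eq_one_iff _).2 (htriv _ hw), one_mul, ← hcomm.eq, QuotientGroup.mk_inv,
    mul_inv_cancel_right]

theorem mk_commutator_commutator (hN : ⁅N, N⁆ ≤ A)
    (hz : ∀ g, ⁅z, g⁆ ∈ sectionCentralizer A N) (g : G) {v : G} (hv : v ∈ N) :
    ((⁅⁅v, g⁆, z⁆ : G) : G ⧸ A) = ((⁅⁅v, z⁆, g⁆ : G) : G ⧸ A) := by
  have hconj : g * v⁻¹ * g⁻¹ ∈ N := Normal.conj_mem ‹_› _ (inv_mem hv) g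
  have hsplit : ⁅v, g⁆ = v * (g * v⁻¹ * g⁻¹) := by simp only [commutatorElement_def, mul_assoc]
  have hinv : ((⁅v⁻¹, z⁆ : G) : G ⧸ A) = (((⁅v, z⁆ : G) : G ⧸ A))⁻¹ :=
    map_inv (commutatorHom hN z) ⟨v, hv⟩
  calc ((⁅⁅v, g⁆, z⁆ : G) : G ⧸ A)
      = ((⁅v, z⁆ : G) : G ⧸ A) * ((⁅g * v⁻¹ * g⁻¹, z⁆ : G) : G ⧸ A) := by
        rw [hsplit]
        exact map_mul (commutatorHom hN z) ⟨v, hv⟩ ⟨_, hconj⟩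
    _ = ((⁅⁅v, z⁆, g⁆ : G) : G ⧸ A) := by
        rw [mk_commutator_conj hz g (inv_mem hv), QuotientGroup.mk_mul, QuotientGroup.mk_mul,
          hinv, mk_commutatorElement A ⁅v, z⁆, commutatorElement_def ((⁅v, z⁆ : G) : G ⧸ A),
          QuotientGroup.mk_inv]
        simp only [mul_assoc]

/-- The image of `v ↦ ⁅v, z⁆` on the abelian section `N / A`, pulled back to `G`. -/
def commutatorImage (hN : ⁅N, N⁆ ≤ A) (z : G) : Subgroup G :=
  (commutatorHom hN z).range.comap (mk' A)

/-- The kernel of `v ↦ ⁅v, z⁆` on the abelian section `N / A`, as a subgroup of `G`. -/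
def commutatorKernel (hN : ⁅N, N⁆ ≤ A) (z : G) : Subgroup G :=
  (commutatorHom hN z).ker.map N.subtype

variable (hN : ⁅N, N⁆ ≤ A)

theorem mem_commutatorImage_iff {x : G} :
    x ∈ commutatorImage hN z ↔ ∃ v ∈ N, ((⁅v, z⁆ : G) : G ⧸ A) = x := by
  simp only [commutatorImage, mem_comap, mk'_apply, MonoidHom.mem_range, Subtype.exists,
    commutatorHom_apply, exists_prop]

theorem mem_commutatorKernel_iff {x : G} :
    x ∈ commutatorKernel hN z ↔ x ∈ N ∧ ⁅x, z⁆ ∈ A := by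
  simp only [commutatorKernel, mem_map, MonoidHom.mem_ker, commutatorHom_apply,
    QuotientGroup.eq_one_iff, subtype_apply, Subtype.exists]
  exact ⟨fun ⟨_, hv, hvz, hvx⟩ => hvx ▸ ⟨hv, hvz⟩, fun ⟨hx, hxz⟩ => ⟨x, hx, hxz, rfl⟩⟩

theorem commutatorElement_mem_commutatorImage {v : G} (hv : v ∈ N) :
    ⁅v, z⁆ ∈ commutatorImage hN z :=
  (mem_commutatorImage_iff hN).2 ⟨v, hv, rfl⟩

theorem le_commutatorImage : A ≤ commutatorImage hN z := fun a ha =>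
  (mem_commutatorImage_iff hN).2 ⟨1, one_mem N, by
    rw [commutatorElement_one_left, (QuotientGroup.eq_one_iff a).2 ha, QuotientGroup.mk_one]⟩

theorem commutatorImage_le (hAN : A ≤ N) : commutatorImage hN z ≤ N := by
  intro x hx
  obtain ⟨v, hv, hvx⟩ := (mem_commutatorImage_iff hN).1 hx
  exact mem_of_mk_eq hAN hvx (commutatorElement_mem_left hv z)

theorem relIndex_commutatorKernel :
    (commutatorKernel hN z).relIndex N = A.relIndex (commutatorImage hN z) := by
  have hker : (commutatorKernel hN z).subgroupOf N = (commutatorHom hN z).ker :=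
    comap_map_eq_self_of_injective N.subtype_injective _
  rw [relIndex, hker, index_ker, ← map_comap_eq_self_of_surjective (mk'_surjective A)
    (commutatorHom hN z).range, ← relIndex_ker, ker_mk', commutatorImage]

theorem commutatorKernel_le_of_commutatorImage_eq (hAN : A ≤ N) (hfin : A.relIndex N ≠ 0)
    (hI : commutatorImage hN z = N) : commutatorKernel hN z ≤ A := by
  have hAK : A ≤ commutatorKernel hN z := fun a ha =>
    (mem_commutatorKernel_iff hN).2 ⟨hAN ha, commutatorElement_mem_left ha z⟩
  have hmul := relIndex_mul_relIndex A (commutatorKernel hN z) N hAK fun x hx =>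
    ((mem_commutatorKernel_iff hN).1 hx).1
  rw [relIndex_commutatorKernel, hI] at hmul
  exact relIndex_eq_one.1 (Nat.eq_of_mul_eq_mul_right (Nat.pos_of_ne_zero hfin)
    (hmul.trans (one_mul _).symm))

theorem commutatorImage_normal (hz : ∀ g, ⁅z, g⁆ ∈ sectionCentralizer A N) :
    (commutatorImage hN z).Normal := by
  refine ⟨fun x hx g => ?_⟩
  obtain ⟨v, hv, hvx⟩ := (mem_commutatorImage_iff hN).1 hx
  refine (mem_commutatorImage_iff hN).2 ⟨g * v * g⁻¹, Normal.conj_mem ‹_› v hv g, ?_⟩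
  rw [mk_commutator_conj hz g hv, QuotientGroup.mk_mul, QuotientGroup.mk_mul, hvx,
    QuotientGroup.mk_mul, QuotientGroup.mk_mul]

theorem le_commutator_commutatorImage_sup (hz : ∀ g, ⁅z, g⁆ ∈ sectionCentralizer A N)
    (hAN : A ≤ N) (hperfect : N ≤ ⁅N, ⊤⁆ ⊔ A) :
    commutatorImage hN z ≤ ⁅commutatorImage hN z, ⊤⁆ ⊔ A := by
  have := commutatorImage_normal hN hz
  have hND : ⁅N, N⁆ ≤ ⁅commutatorImage hN z, ⊤⁆ ⊔ A := hN.trans le_sup_right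
  have hcomm : ⁅N, ⊤⁆ ≤ commutatorKernel hND z := commutator_le.2 fun v hv g _ =>
    (mem_commutatorKernel_iff hND).2 ⟨commutatorElement_mem_left hv g,
      mem_of_mk_eq le_sup_right (mk_commutator_commutator hN hz g hv).symm <| mem_sup_left <|
        commutator_mem_commutator (commutatorElement_mem_commutatorImage hN hv) (mem_top g)⟩
  have hA : A ≤ commutatorKernel hND z := fun a ha => (mem_commutatorKernel_iff hND).2
    ⟨hAN ha, commutatorElement_mem_left (mem_sup_right ha) z⟩
  intro x hx
  obtain ⟨v, hv, hvx⟩ := (mem_commutatorImage_iff hN).1 hx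
  exact mem_of_mk_eq le_sup_right hvx
    ((mem_commutatorKernel_iff hND).1 (hperfect.trans (sup_le hcomm hA) hv)).2

end CommutatorHom

section FixedPointFree

variable {G : Type u} [Group G] {A N W : Subgroup G}

theorem relIndex_lt_of_lt_of_lt {K : Subgroup G} (hAK : A < K) (hKW : K < W)
    (hfin : A.relIndex W ≠ 0) : (A.relIndex K ≠ 0 ∧ A.relIndex K < A.relIndex W) ∧
      K.relIndex W ≠ 0 ∧ K.relIndex W < A.relIndex W := by
  have hmul := relIndex_mul_relIndex A K W hAK.le hKW.le
  rw [← hmul] at hfin ⊢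
  have hAK1 : A.relIndex K ≠ 1 := fun h => hAK.not_ge (relIndex_eq_one.1 h)
  have hKW1 : K.relIndex W ≠ 1 := fun h => hKW.not_ge (relIndex_eq_one.1 h)
  have hAK0 := left_ne_zero_of_mul hfin
  have hKW0 := right_ne_zero_of_mul hfin
  exact ⟨⟨hAK0, lt_mul_of_one_lt_right (by omega) (by omega)⟩,
    hKW0, lt_mul_of_one_lt_left (by omega) (by omega)⟩

instance upperCentralSeriesStep_normal [W.Normal] : W.upperCentralSeriesStep.Normal :=
  Subgroup.upperCentralSeriesStep_eq_comap_center W ▸ inferInstance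

/- Choose `z` acting nontrivially on `N / A` and central modulo the elements acting trivially, so
that `v ↦ ⁅v, z⁆` is an endomorphism of the `G`-section `N / A`. If it is onto, it is injective by
finiteness and fixed points lie in its kernel; otherwise its image cuts the section in two. -/
theorem IsHypercentralSection.fixedPointFree_of_perfect [A.Normal] [N.Normal]
    (h : IsHypercentralSection A N) (hAN : A ≤ N) (hfin : A.relIndex N ≠ 0)
    (hperfect : N ≤ ⁅N, ⊤⁆ ⊔ A) : FixedPointFree A N := by
  induction hk : A.relIndex N using Nat.strong_induction_on generalizing A N with
  | _ k ih =>
  subst hk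
  intro x hxN hx
  by_cases hcentral : ⁅N, ⊤⁆ ≤ A
  · exact hperfect.trans (sup_le hcentral le_rfl) hxN
  obtain ⟨z, hz, v, hv, hvz⟩ := h.exists_central_mod_sectionCentralizer hcentral
  have hIn : (commutatorImage h.abelian z).Normal := commutatorImage_normal h.abelian hz
  have hAI : A < commutatorImage h.abelian z := lt_of_le_of_ne (le_commutatorImage _) fun hAI =>
    hvz (hAI.ge (commutatorElement_mem_commutatorImage _ hv))
  rcases (commutatorImage_le h.abelian (z := z) hAN).eq_or_lt with hIN | hIN
  · exact commutatorKernel_le_of_commutatorImage_eq h.abelian hAN hfin hIN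
      ((mem_commutatorKernel_iff h.abelian).2 ⟨hxN, hx z⟩)
  obtain ⟨hI, hN⟩ := relIndex_lt_of_lt_of_lt hAI hIN hfin
  have hxI : x ∈ commutatorImage h.abelian z :=
    ih _ hN.2 (h.mono_left hAI.le) hIN.le hN.1 (hperfect.trans (sup_le_sup_left hAI.le _)) rfl
      x hxN fun g => hAI.le (hx g)
  exact ih _ hI.2 (h.mono_right hIN.le) hAI.le hI.1
    (le_commutator_commutatorImage_sup h.abelian hz hAN hperfect) rfl x hxI hx

theorem le_of_commutatorImage_eq [A.Normal] [N.Normal] [W.Normal] {z : G} (hN : ⁅N, N⁆ ≤ A)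
    (hW : ⁅W, W⁆ ≤ A) (hz : ∀ g, ⁅z, g⁆ ∈ sectionCentralizer A N) (hfree : FixedPointFree A N)
    (hAW : A ≤ W) (hWN : W ≤ N) (hNW : ⁅N, ⊤⁆ ≤ W) (hfin : A.relIndex W ≠ 0)
    (hI : commutatorImage hW z = W) : N ≤ W := by
  intro x hx
  obtain ⟨w, hw, hwx⟩ :=
    (mem_commutatorImage_iff hW).1 (hI.ge (commutator_le.1 hNW x hx z (mem_top z)))
  have hyN : w⁻¹ * x ∈ N := N.mul_mem (N.inv_mem (hWN hw)) hx
  have hyz : ⁅w⁻¹ * x, z⁆ ∈ A := by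
    have hmap : commutatorHom hN z (⟨w, hWN hw⟩⁻¹ * ⟨x, hx⟩) = 1 := by
      rw [map_mul, map_inv, inv_mul_eq_one]
      exact hwx
    exact (QuotientGroup.eq_one_iff _).1 hmap
  have hyA : w⁻¹ * x ∈ A := hfree _ hyN fun g =>
    commutatorKernel_le_of_commutatorImage_eq hW hAW hfin hI <| (mem_commutatorKernel_iff hW).2
      ⟨commutator_le.1 hNW _ hyN g (mem_top g),
        mem_of_mk_eq le_rfl (mk_commutator_commutator hN hz g hyN).symm
          (commutatorElement_mem_left hyz g)⟩
  simpa only [mul_inv_cancel_left] using W.mul_mem hw (hAW hyA)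

/- As for `fixedPointFree_of_perfect`, with `v ↦ ⁅v, z⁆` now restricted to `W / A`. -/
theorem IsHypercentralSection.le_of_commutator_le [A.Normal] [N.Normal] [W.Normal]
    (h : IsHypercentralSection A N) (hfree : FixedPointFree A N) (hAW : A ≤ W) (hWN : W ≤ N)
    (hNW : ⁅N, ⊤⁆ ≤ W) (hfin : A.relIndex W ≠ 0) : N ≤ W := by
  induction hk : A.relIndex W using Nat.strong_induction_on generalizing A N W with
  | _ k ih =>
  subst hk
  by_cases hcentral : ⁅N, ⊤⁆ ≤ A
  · exact fun x hx => hAW (hfree x hx fun g => commutator_le.1 hcentral x hx g (mem_top g))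
  obtain ⟨z, hz, v, hv, hvz⟩ := h.exists_central_mod_sectionCentralizer hcentral
  have hW : ⁅W, W⁆ ≤ A := (h.mono_right hWN).abelian
  have hzW : ∀ g, ⁅z, g⁆ ∈ sectionCentralizer A W := fun g =>
    sectionCentralizer_anti_right hWN (hz g)
  have hIn : (commutatorImage hW z).Normal := commutatorImage_normal hW hzW
  have hAI : A < commutatorImage hW z := lt_of_le_of_ne (le_commutatorImage hW) fun hAI =>
    hvz <| hfree _ (commutatorElement_mem_left hv z) fun g =>
      mem_of_mk_eq le_rfl (mk_commutator_commutator h.abelian hz g hv) <| hAI.ge <|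
        commutatorElement_mem_commutatorImage hW (commutator_le.1 hNW v hv g (mem_top g))
  rcases (commutatorImage_le hW (z := z) hAW).eq_or_lt with hIW | hIW
  · exact le_of_commutatorImage_eq h.abelian hW hz hfree hAW hWN hNW hfin hIW
  obtain ⟨hI, hWI⟩ := relIndex_lt_of_lt_of_lt hAI hIW hfin
  have hfreeI : FixedPointFree (commutatorImage hW z) N := by
    intro x hx hxI
    exact ih _ hI.2 (N := N ⊓ (commutatorImage hW z).upperCentralSeriesStep)
      (h.mono_right inf_le_left) (fun y hy => hfree y hy.1) hAI.le
      (le_inf (hIW.le.trans hWN) fun y hy => commutatorElement_mem_left hy)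
      (commutator_le.2 fun y hy g _ => hy.2 g) hI.1 rfl ⟨hx, hxI⟩
  exact ih _ hWI.2 (h.mono_left hAI.le) hfreeI hIW.le hWN hNW hWI.1 rfl

end FixedPointFree

section FiniteByHypercentral

variable {G : Type u} [Group G]

theorem fixedPointFree_bot_top_of_center_eq_bot (h : center G = ⊥) :
    FixedPointFree (⊥ : Subgroup G) ⊤ := fun _ _ hx =>
  h.le (mem_center_iff.2 fun g => (commutatorElement_eq_one_iff_mul_comm.1 (hx g)).symm)

theorem center_quotient_hypercenter : center (G ⧸ hypercenter G) = ⊥ := by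
  refine (eq_bot_iff_forall _).2 fun x hx => ?_
  obtain ⟨x, rfl⟩ := mk'_surjective (hypercenter G) x
  refine (QuotientGroup.eq_one_iff x).2 (mem_hypercenter_of_commutator_mem fun g => ?_)
  exact commute_mk_iff.1 (mem_center_iff.1 hx g).symm

theorem index_centralizer_le (L : Subgroup G) [L.Normal] [Finite L] :
    (centralizer (L : Set G)).index ≠ 0 ∧
      (centralizer (L : Set G)).index ≤ (Nat.card L).factorial := by
  have hker : (MulAut.conjNormal (H := L)).ker = centralizer (L : Set G) := by
    ext g
    rw [MonoidHom.mem_ker, MulEquiv.ext_iff, mem_centralizer_iff, Subtype.forall]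
    refine forall₂_congr fun a ha => ?_
    rw [Subtype.ext_iff, MulAut.conjNormal_apply, MulAut.one_apply, mul_inv_eq_iff_eq_mul, eq_comm]
  have hinj : Function.Injective (MulEquiv.toEquiv : MulAut L → Equiv.Perm L) :=
    MulEquiv.toEquiv_injective
  have : Finite (MulAut L) := Finite.of_injective _ hinj
  rw [← hker, index_ker, ← Nat.card_perm]
  exact ⟨Nat.card_pos.ne', Nat.card_le_card_of_injective _ (hinj.comp Subtype.val_injective)⟩

theorem centralizer_le_of_center_eq_bot (hG : center G = ⊥) (L : Subgroup G) [L.Normal] [Finite L]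
    (hL : hypercenterOver L = ⊤) : centralizer (L : Set G) ≤ L := by
  set C := centralizer (L : Set G)
  have hfree := fixedPointFree_bot_top_of_center_eq_bot hG
  have hCL : ⁅C, L⁆ = ⊥ := commutator_eq_bot_iff_le_centralizer.2 le_rfl
  set X := C ⊓ L.upperCentralSeriesStep
  have hXC : X ≤ C := inf_le_left
  have hXL : ⁅X, ⊤⁆ ≤ L := commutator_le.2 fun x hx g _ => hx.2 g
  have hXX : ⁅X, X⁆ ≤ ⊥ := by
    have hLX : ⁅⁅X, ⊤⁆, X⁆ = ⊥ :=
      le_bot_iff.1 ((commutator_mono hXL hXC).trans (commutator_comm L C ▸ hCL.le))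
    have hrot : ⁅⁅X, X⁆, ⊤⁆ = ⊥ :=
      commutator_commutator_eq_bot_of_rotate hLX (commutator_comm X ⊤ ▸ hLX)
    exact fun x hx => hfree x (mem_top x) fun g =>
      hrot.le (commutator_mem_commutator hx (mem_top g))
  have hsection : IsHypercentralSection ⊥ X :=
    .of_commutator_le hXX ((commutator_mono hXC le_rfl).trans hCL.le) hL
  have hXW : X ≤ C ⊓ L := by
    refine hsection.le_of_commutator_le (fun x _ => hfree x (mem_top x)) bot_le
      (inf_le_inf_left _ fun x hx => commutatorElement_mem_left hx)
      (le_inf ((commutator_le_left _ _).trans hXC) hXL) ?_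
    rw [relIndex_bot_left]
    have := Finite.of_injective _ (inclusion_injective (inf_le_right : C ⊓ L ≤ L))
    exact Nat.card_pos.ne'
  have hfreeC : FixedPointFree L C := fun x hx hxL => (hXW ⟨hx, hxL⟩).2
  simpa only [hL, inf_top_eq] using hfreeC.inf_hypercenterOver_le le_rfl

/-- A bound for the index of the hypercenter of a group that is hypercentral modulo a normal
subgroup of order at most `m`: when the center is trivial, `m !` bounds the index of the centralizer
of that subgroup and `m` its order. -/
def hypercenterBound (m : ℕ) : ℕ := m.factorial * m

theorem hypercenterBound_mono : Monotone hypercenterBound := fun _ _ h =>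
  Nat.mul_le_mul (Nat.factorial_le h) h

theorem card_le_hypercenterBound_of_center_eq_bot (hG : center G = ⊥) (L : Subgroup G) [L.Normal]
    [Finite L] (hL : hypercenterOver L = ⊤) :
    Nat.card G ≠ 0 ∧ Nat.card G ≤ hypercenterBound (Nat.card L) := by
  have hle := centralizer_le_of_center_eq_bot hG L hL
  have hfin := Finite.of_injective _ (inclusion_injective hle)
  obtain ⟨hindex, hindex_le⟩ := index_centralizer_le L
  rw [← index_mul_card (centralizer (L : Set G))]
  exact ⟨mul_ne_zero hindex Nat.card_pos.ne',
    Nat.mul_le_mul hindex_le (Nat.card_le_card_of_injective _ (inclusion_injective hle))⟩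

theorem index_hypercenter_le (L : Subgroup G) [L.Normal] [Finite L]
    (hL : hypercenterOver L = ⊤) :
    (hypercenter G).index ≠ 0 ∧ (hypercenter G).index ≤ hypercenterBound (Nat.card L) := by
  have hsurj := mk'_surjective (hypercenter G)
  have hLn : (L.map (mk' (hypercenter G))).Normal := Normal.map ‹_› _ hsurj
  have hLsurj := (mk' (hypercenter G)).subgroupMap_surjective L
  have hLfin : Finite (L.map (mk' (hypercenter G))) := Finite.of_surjective _ hLsurj
  obtain ⟨hcard, hcard_le⟩ :=
    card_le_hypercenterBound_of_center_eq_bot center_quotient_hypercenter _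
      (hypercenterOver_map_eq_top hsurj hL)
  exact ⟨hcard, hcard_le.trans (hypercenterBound_mono (Nat.card_le_card_of_surjective _ hLsurj))⟩

theorem index_hypercenterOver_le {A B : Subgroup G} [A.Normal] [B.Normal]
    (hAB : A.relIndex B ≠ 0) (hB : hypercenterOver B = ⊤) :
    (hypercenterOver A).index ≠ 0 ∧
      (hypercenterOver A).index ≤ hypercenterBound (A.relIndex B) := by
  have hsurj := mk'_surjective A
  have hBn : (B.map (mk' A)).Normal := Normal.map ‹_› _ hsurj
  have hcard : Nat.card (B.map (mk' A)) = A.relIndex B := by rw [← relIndex_ker, ker_mk']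
  have hfin : Finite (B.map (mk' A)) := Nat.finite_of_card_ne_zero (hcard ▸ hAB)
  rw [hypercenterOver, index_comap_of_surjective _ hsurj, ← hcard]
  exact index_hypercenter_le _ (hypercenterOver_map_eq_top hsurj hB)

end FiniteByHypercentral

section FiniteCommutator

open scoped IsMulCommutative

variable {G : Type u} [Group G] {N : Subgroup G}

theorem commutatorElement_mul_mul_of_mem_center {x y z w : G} (hz : z ∈ center G)
    (hw : w ∈ center G) : ⁅x * z, y * w⁆ = ⁅x, y⁆ := by
  have hzy : ⁅z, y * w⁆ = 1 :=
    commutatorElement_eq_one_iff_mul_comm.2 (mem_center_iff.1 hz _).symm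
  have hxw : ⁅x, w⁆ = 1 := commutatorElement_eq_one_iff_mul_comm.2 (mem_center_iff.1 hw x)
  rw [commutatorElement_mul_left_eq_conj_mul, hzy, mul_one, mul_inv_cancel, one_mul,
    commutatorElement_mul_right_eq_mul_conj, hxw, mul_one, mul_inv_cancel_right]

theorem commutator_closure_le [N.Normal] {S : Set G} {D : Subgroup G}
    (h : ∀ x ∈ N, ∀ s ∈ S, ⁅x, s⁆ ∈ D) : ⁅N, closure S⁆ ≤ D := by
  refine commutator_le.2 fun x hx g hg => ?_
  induction hg using closure_induction generalizing x with
  | mem s hs => exact h x hx s hs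
  | one => exact (commutatorElement_one_right x).symm ▸ one_mem D
  | mul a b _ _ ha hb =>
    have hxb : ⁅x, b⁆ ∈ N := commutatorElement_mem_left hx b
    have hsplit : ⁅x, a * b⁆ = ⁅x, a⁆ * (⁅⁅x, b⁆, a⁆⁻¹ * ⁅x, b⁆) := by
      simp only [commutatorElement_def]
      group
    exact hsplit ▸ mul_mem (ha x hx) (mul_mem (inv_mem (ha _ hxb)) (hb x hx))
  | inv a _ ha =>
    have hconj : a⁻¹ * x * a ∈ N := by simpa only [inv_inv] using Normal.conj_mem ‹_› x hx a⁻¹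
    have hsplit : ⁅x, a⁻¹⁆ = ⁅a⁻¹ * x * a, a⁆⁻¹ := by
      simp only [commutatorElement_def]
      group
    exact hsplit ▸ inv_mem (ha _ hconj)

theorem fg_commutator_top [hG : Group.FG G] [N.Normal] (hN : (center G).relIndex N ≠ 0) :
    (⁅N, ⊤⁆ : Subgroup G).FG := by
  obtain ⟨T, hT⟩ := hG.out
  let Q := N ⧸ (center G).subgroupOf N
  have : Finite Q := Nat.finite_of_card_ne_zero hN
  let c : Q × T → G := fun q => ⁅(q.1.out : G), (q.2 : G)⁆
  refine (fg_iff _).2 ⟨Set.range c, le_antisymm ?_ ?_, Set.finite_range c⟩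
  · refine (closure_le _).2 ?_
    rintro _ ⟨q, rfl⟩
    exact commutator_mem_commutator q.1.out.2 (mem_top _)
  · rw [← hT]
    refine commutator_closure_le fun x hx s hs => ?_
    obtain ⟨⟨⟨z, _⟩, hz⟩, hxz⟩ := mk_out_eq_mul ((center G).subgroupOf N) ⟨x, hx⟩
    refine subset_closure ⟨((⟨x, hx⟩ : N), ⟨s, hs⟩), ?_⟩
    have hcz := commutatorElement_mul_mul_of_mem_center (x := x) (y := s) hz (one_mem _)
    rw [mul_one] at hcz
    exact (congrArg (fun y : N => ⁅(y : G), s⁆) hxz).trans hcz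

/- By the transfer into the center of `N`, raising to the power `|N : Z(N)|` is a homomorphism on
`N`; a further power lands in the center of `G` and so kills all commutators. -/
theorem exists_pow_eq_one_of_mem_commutator_top [N.Normal] (hN : (center G).relIndex N ≠ 0) :
    ∃ e ≠ 0, ∀ x ∈ ⁅N, (⊤ : Subgroup G)⁆, x ^ e = 1 := by
  have hcenter : (center G).subgroupOf N ≤ center N := fun z hz =>
    mem_center_iff.2 fun x => Subtype.ext (mem_center_iff.1 (mem_subgroupOf.1 hz) x)
  have : ((center G).subgroupOf N).FiniteIndex := ⟨hN⟩
  have : (center N).FiniteIndex := finiteIndex_of_le hcenter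
  set j := (center G).relIndex N
  set k := (center N).index
  let φ : N →* center N := (powMonoidHom j).comp (MonoidHom.transferCenterPow N)
  have hφ (x : N) : ((φ x : N) : G) = (x : G) ^ (k * j) := by
    simp only [φ, MonoidHom.comp_apply, powMonoidHom_apply, coe_pow,
      MonoidHom.transferCenterPow_apply, pow_mul, k]
  suffices h : ⁅N, (⊤ : Subgroup G)⁆ ≤ φ.ker.map N.subtype by
    refine ⟨k * j, mul_ne_zero FiniteIndex.index_ne_zero hN, fun x hx => ?_⟩
    obtain ⟨y, hy, rfl⟩ := mem_map.1 (h hx)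
    rw [subtype_apply, ← hφ, MonoidHom.mem_ker.1 hy, coe_one, coe_one]
  refine commutator_le.2 fun x hx g _ => ?_
  have hconj : g * x⁻¹ * g⁻¹ ∈ N := Normal.conj_mem ‹_› _ (inv_mem hx) g
  refine ⟨⟨x, hx⟩ * ⟨_, hconj⟩, ?_, by
    simp only [commutatorElement_def, subtype_apply, coe_mul, mul_assoc]⟩
  have hxe : x ^ (k * j) ∈ center G := by
    rw [mul_comm, pow_mul]
    exact pow_mem (pow_relIndex_mem _ hx) k
  refine MonoidHom.mem_ker.2 (Subtype.ext (Subtype.ext ?_))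
  rw [map_mul, coe_mul, coe_mul, hφ, hφ, conj_pow, inv_pow,
    mem_center_iff.1 (inv_mem hxe) g, mul_inv_cancel_right, mul_inv_cancel, coe_one, coe_one]

theorem finite_commutator_top [Group.FG G] [N.Normal] (hN : (center G).relIndex N ≠ 0) :
    Finite (⁅N, ⊤⁆ : Subgroup G) := by
  set K : Subgroup G := ⁅N, ⊤⁆
  have hK : Group.FG K := (Group.fg_iff_subgroup_fg K).2 (fg_commutator_top hN)
  have hcenter : (center G).subgroupOf K ≤ center K := fun z hz =>
    mem_center_iff.2 fun x => Subtype.ext (mem_center_iff.1 (mem_subgroupOf.1 hz) x)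
  have : ((center G).subgroupOf K).FiniteIndex :=
    ⟨fun h => hN (relIndex_eq_zero_of_le_right (commutator_le_left N ⊤) h)⟩
  have : (center K).FiniteIndex := finiteIndex_of_le hcenter
  obtain ⟨e, he, hpow⟩ := exists_pow_eq_one_of_mem_commutator_top hN
  have : Finite (center K) := CommGroup.finite_of_fg_isMulTorsion _ fun x =>
    isOfFinOrder_iff_pow_eq_one.2
      ⟨e, Nat.pos_of_ne_zero he, Subtype.ext (Subtype.ext (hpow x.1 x.1.2))⟩
  refine Nat.finite_of_card_ne_zero ?_
  rw [← index_mul_card (center K)]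
  exact mul_ne_zero FiniteIndex.index_ne_zero Nat.card_pos.ne'

theorem finite_lowerCentralSeries [Group.FG G] {n : ℕ}
    (hn : (Subgroup.upperCentralSeries G n).index ≠ 0) :
    Finite ((⊤ : Subgroup G).lowerCentralSeries n) := by
  induction n generalizing G with
  | zero =>
    rw [Subgroup.upperCentralSeries_zero, index_bot] at hn
    have := Nat.finite_of_card_ne_zero hn
    infer_instance
  | succ n ih =>
    have hsurj := mk'_surjective (center G)
    rw [← Subgroup.comap_upperCentralSeries_quotient_center,
      index_comap_of_surjective _ hsurj] at hn
    have hfin := ih hn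
    rw [← map_top_of_surjective _ hsurj, ← Subgroup.map_lowerCentralSeries] at hfin
    refine finite_commutator_top (N := (⊤ : Subgroup G).lowerCentralSeries n) ?_
    rw [← ker_mk' (center G), relIndex_ker]
    exact Nat.card_pos.ne'

end FiniteCommutator

section CentralSeries

variable {G : Type u} [Group G]

theorem exists_mem_upperCentralSeries [hG : Group.FG G] {x : G} (hx : x ∈ hypercenter G) :
    ∃ n, x ∈ Subgroup.upperCentralSeries G n := by
  refine hypercenter_induction (p := fun x => ∃ n, x ∈ Subgroup.upperCentralSeries G n)
    ⟨0, one_mem _⟩ (fun x hx => ?_) hx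
  choose a ha using hx
  obtain ⟨T, hT⟩ := hG.out
  set Z := Subgroup.upperCentralSeries G (T.sup a)
  refine ⟨T.sup a + 1, Subgroup.mem_upperCentralSeries_succ_iff.2 fun g => ?_⟩
  have hle : closure (T : Set G) ≤ (centralizer {(x : G ⧸ Z)}).comap (mk' Z) :=
    (closure_le _).2 fun t ht => mem_centralizer_singleton_iff.2 <| Eq.symm <|
      commute_mk_iff.2 (Subgroup.upperCentralSeries_mono G (Finset.le_sup ht) (ha t))
  exact commute_mk_iff.1 (mem_centralizer_singleton_iff.1 (hle (hT ▸ mem_top g))).symm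

theorem exists_le_upperCentralSeries [Group.FG G] {Z : Subgroup G} (hZ : Z.FG)
    (hle : Z ≤ hypercenter G) : ∃ n, Z ≤ Subgroup.upperCentralSeries G n := by
  obtain ⟨T, rfl⟩ := hZ
  choose! a ha using fun x (hx : x ∈ closure (T : Set G)) => exists_mem_upperCentralSeries (hle hx)
  refine ⟨T.sup a, (closure_le _).2 fun t ht => ?_⟩
  exact Subgroup.upperCentralSeries_mono G (Finset.le_sup ht) (ha t (subset_closure ht))

theorem commutator_commutator_le_of_rotate {N H₁ H₂ H₃ : Subgroup G} [N.Normal]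
    (h₁ : ⁅⁅H₂, H₃⁆, H₁⁆ ≤ N) (h₂ : ⁅⁅H₃, H₁⁆, H₂⁆ ≤ N) : ⁅⁅H₁, H₂⁆, H₃⁆ ≤ N := by
  rw [← ker_mk' N, ← Subgroup.map_eq_bot_iff, map_commutator, map_commutator] at *
  exact commutator_commutator_eq_bot_of_rotate h₁ h₂

theorem commutator_lowerCentralSeries_upperCentralSeries_le (i n : ℕ) :
    ⁅(⊤ : Subgroup G).lowerCentralSeries i, Subgroup.upperCentralSeries G (n + i + 1)⁆ ≤
      Subgroup.upperCentralSeries G n := by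
  induction i generalizing n with
  | zero => exact (commutator_comm _ _).trans_le (Subgroup.commutator_upperCentralSeries_top_le G n)
  | succ i ih =>
    rw [Subgroup.lowerCentralSeries_succ]
    refine commutator_commutator_le_of_rotate ?_ ?_
    · rw [commutator_comm ⊤, commutator_comm]
      exact (commutator_mono le_rfl
        (Subgroup.commutator_upperCentralSeries_top_le G _)).trans (ih n)
    · rw [commutator_comm (Subgroup.upperCentralSeries G _), ← add_assoc n, add_right_comm n]
      exact (commutator_mono (ih (n + 1)) le_rfl).trans
        (Subgroup.commutator_upperCentralSeries_top_le G n)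

theorem hypercenterOver_eq_top_of_lowerCentralSeries_le {A F : Subgroup G} [A.Normal]
    (hFA : F ⊔ hypercenterOver A = ⊤) {n : ℕ} (h : F.lowerCentralSeries n ≤ hypercenterOver A) :
    hypercenterOver A = ⊤ := by
  induction n with
  | zero => exact (sup_eq_right.2 h).symm.trans hFA
  | succ n ih =>
    refine ih fun x hx => mem_hypercenterOver_of_commutator_mem fun g => ?_
    obtain ⟨y, hy, k, hk, rfl⟩ := mem_sup_of_normal_right.1 (hFA.ge (mem_top g))
    rw [commutatorElement_mul_right_eq_mul_conj, mul_assoc ⁅x, y⁆, mul_assoc ⁅x, y⁆]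
    refine mul_mem (h (commutator_mem_commutator hx hy)) (Normal.conj_mem inferInstance _ ?_ y)
    exact commutator_le_right ⊤ _ (commutator_mem_commutator (mem_top x) hk)

end CentralSeries

section NilpotentResidual

variable {G : Type u} [Group G]

/-- The intersection of the lower central series of `F`. It is the smallest normal subgroup of `F`
with nilpotent quotient as soon as there is one. -/
def nilpotentResidual (F : Subgroup G) : Subgroup G := ⨅ m, F.lowerCentralSeries m

theorem nilpotentResidual_mono : Monotone (nilpotentResidual (G := G)) :=
  fun _ _ h => iInf_mono fun m => Subgroup.lowerCentralSeries_mono m h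

theorem exists_nilpotentResidual_eq {F : Subgroup G} {n : ℕ}
    (hfin : Finite (F.lowerCentralSeries n)) :
    ∃ m, nilpotentResidual F = F.lowerCentralSeries m := by
  obtain ⟨m, hnm, hmin⟩ := exists_minimalFor_of_wellFoundedLT (n ≤ ·)
    (fun m => Nat.card (F.lowerCentralSeries m)) ⟨n, le_rfl⟩
  have : Finite (F.lowerCentralSeries m) := Finite.of_injective _
    (inclusion_injective (F.lowerCentralSeries_antitone hnm))
  refine ⟨m, le_antisymm (iInf_le _ m) (le_iInf fun j => ?_)⟩
  rcases le_total j m with hjm | hmj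
  · exact F.lowerCentralSeries_antitone hjm
  · have hle := F.lowerCentralSeries_antitone hmj
    exact (eq_of_le_of_card_ge hle (hmin (hnm.trans hmj)
      (Nat.card_le_card_of_injective _ (inclusion_injective hle)))).ge

theorem subgroupOf_hypercenter_le (F : Subgroup G) :
    (hypercenter G).subgroupOf F ≤ hypercenter F := by
  rw [← hypercenterOver_bot, ← hypercenterOver_bot]
  have h := comap_hypercenterOver_le (A := ⊥) F.subtype
  refine h.trans (hypercenterOver_mono ?_)
  rw [MonoidHom.comap_bot, ker_subtype]

theorem finite_nilpotentResidual (hZ : (hypercenter G).index ≠ 0) {F : Subgroup G} (hF : F.FG) :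
    Finite (nilpotentResidual F) ∧ ∃ m, nilpotentResidual F = F.lowerCentralSeries m := by
  have : Group.FG F := (Group.fg_iff_subgroup_fg F).2 hF
  have hZF : ((hypercenter G).subgroupOf F).FiniteIndex :=
    ⟨fun h => hZ (index_eq_zero_of_relIndex_eq_zero h)⟩
  obtain ⟨n, hn⟩ := exists_le_upperCentralSeries
    ((Group.fg_iff_subgroup_fg ((hypercenter G).subgroupOf F)).1 inferInstance)
    (subgroupOf_hypercenter_le F)
  have hfin := finite_lowerCentralSeries (finiteIndex_of_le hn).index_ne_zero
  have hfinF : Finite (F.lowerCentralSeries n) := by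
    rw [← Subgroup.top_subtype_lowerCentralSeries]
    exact Finite.of_surjective _ (F.subtype.subgroupMap_surjective _)
  exact ⟨Finite.of_injective _ (inclusion_injective (iInf_le _ n)),
    exists_nilpotentResidual_eq hfinF⟩

theorem nilpotentResidual_le_centralizer_hypercenter {F : Subgroup G} (hF : F.FG) :
    nilpotentResidual F ≤ centralizer (hypercenter G : Set G) := by
  refine fun x hx => mem_centralizer_iff.2 fun z hz => ?_
  set H := F ⊔ closure {z}
  have : Group.FG H :=
    (Group.fg_iff_subgroup_fg H).2 (hF.sup ((fg_iff _).2 ⟨{z}, rfl, Set.finite_singleton z⟩))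
  have hzH : z ∈ H := mem_sup_right (mem_closure_singleton_self z)
  obtain ⟨n, hn⟩ := exists_mem_upperCentralSeries (x := ⟨z, hzH⟩) (subgroupOf_hypercenter_le H hz)
  have hxH : x ∈ H.lowerCentralSeries n :=
    (nilpotentResidual_mono le_sup_left).trans (iInf_le _ n) hx
  rw [← Subgroup.top_subtype_lowerCentralSeries] at hxH
  obtain ⟨y, hy, rfl⟩ := mem_map.1 hxH
  have hcomm := commutator_lowerCentralSeries_upperCentralSeries_le n 0
    (commutator_mem_commutator hy (Subgroup.upperCentralSeries_mono H (by omega) hn))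
  exact congrArg Subtype.val (commutatorElement_eq_one_iff_mul_comm.1 (mem_bot.1 hcomm)).symm

end NilpotentResidual

section HypercentralByFinite

variable {G : Type u} [Group G]

theorem card_commutator_le (hZ : (center G).index ≠ 0) :
    Nat.card (commutator G) ≤
      (center G).index ^ ((center G).index * ((center G).index * (center G).index) + 1) := by
  have : Finite (G ⧸ center G) := Nat.finite_of_card_ne_zero hZ
  let c : (G ⧸ center G) × (G ⧸ center G) → commutatorSet G :=
    fun q => ⟨⁅q.1.out, q.2.out⁆, commutator_mem_commutatorSet _ _⟩
  have hc : Function.Surjective c := by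
    rintro ⟨_, a, b, rfl⟩
    obtain ⟨⟨z, hz⟩, haz⟩ := mk_out_eq_mul (center G) a
    obtain ⟨⟨w, hw⟩, hbw⟩ := mk_out_eq_mul (center G) b
    refine ⟨(a, b), Subtype.ext ?_⟩
    exact (congrArg₂ Bracket.bracket haz hbw).trans (commutatorElement_mul_mul_of_mem_center hz hw)
  have : Finite (commutatorSet G) := Finite.of_surjective c hc
  have hcard : Nat.card (commutatorSet G) ≤ (center G).index * (center G).index :=
    (Nat.card_le_card_of_surjective c hc).trans (Nat.card_prod _ _).le
  have hpos := Nat.pos_of_ne_zero hZ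
  refine (Nat.le_of_dvd (pow_pos hpos _) (card_commutator_dvd_index_center_pow G)).trans
    (Nat.pow_le_pow_right hpos ?_)
  gcongr

/-- A bound for the order of a finite normal subgroup with hypercentral quotient, in terms of the
index `k` of the hypercenter: the power is Schur's bound for the order of the derived subgroup, and
the last factor bounds its index. -/
def residualBound (k : ℕ) : ℕ := k ^ (k * (k * k) + 1) * k

theorem residualBound_mono : Monotone residualBound := by
  intro k l h
  rcases k.eq_zero_or_pos with rfl | hk
  · exact (Nat.mul_zero _).trans_le (Nat.zero_le _)
  unfold residualBound
  gcongr
  exact hk.trans_le h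

theorem card_le_residualBound {R : Subgroup G} [R.Normal] [Finite R]
    (hZ : (hypercenter G).index ≠ 0) (hRZ : R ≤ centralizer (hypercenter G : Set G))
    (hperfect : R ≤ ⁅R, ⊤⁆) (hR : hypercenterOver R = ⊤) :
    Nat.card R ≤ residualBound (hypercenter G).index := by
  set k := (hypercenter G).index
  have hpos : 0 < k := Nat.pos_of_ne_zero hZ
  have hZR : (hypercenter G).relIndex R ≠ 0 := fun h => hZ (index_eq_zero_of_relIndex_eq_zero h)
  have hZRk : (hypercenter G).relIndex R ≤ k :=
    Nat.le_of_dvd hpos (relIndex_dvd_index_of_normal _ R)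
  have hcommutator : Nat.card (⁅R, R⁆ : Subgroup G) ≤ k ^ (k * (k * k) + 1) := by
    have hcenter : (hypercenter G).subgroupOf R ≤ center R := fun z hz => mem_center_iff.2 fun x =>
      Subtype.ext (mem_centralizer_iff.1 (hRZ x.2) z (mem_subgroupOf.1 hz)).symm
    have : ((hypercenter G).subgroupOf R).FiniteIndex := ⟨hZR⟩
    have : (center R).FiniteIndex := finiteIndex_of_le hcenter
    have hindex : (center R).index ≤ k := (index_antitone hcenter).trans hZRk
    rw [← map_subtype_commutator, card_map_of_injective R.subtype_injective]
    refine (card_commutator_le FiniteIndex.index_ne_zero).trans ?_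
    gcongr
  have hquotient : (⁅R, R⁆ : Subgroup G).relIndex R ≤ k := by
    have hsection : IsHypercentralSection ⁅R, R⁆ R := .of_commutator_le le_rfl le_rfl hR
    have hfree : FixedPointFree ⁅R, R⁆ R := hsection.fixedPointFree_of_perfect
      (commutator_le_left R R) FiniteIndex.index_ne_zero (hperfect.trans le_sup_left)
    have hle : R ⊓ hypercenter G ≤ ⁅R, R⁆ := hypercenterOver_bot (G := G) ▸
      hfree.inf_hypercenterOver_le bot_le
    rw [← inf_relIndex_left] at hZR hZRk
    exact (relIndex_le_of_le_left hle hZR).trans hZRk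
  rw [← relIndex_bot_left, ← relIndex_mul_relIndex ⊥ ⁅R, R⁆ R bot_le (commutator_le_left R R),
    relIndex_bot_left]
  exact Nat.mul_le_mul hcommutator hquotient

theorem exists_finite_hypercenterOver_eq_top (hZ : (hypercenter G).index ≠ 0) :
    ∃ L : Subgroup G, ∃ _ : L.Normal, Finite L ∧
      Nat.card L ≤ residualBound (hypercenter G).index ∧ hypercenterOver L = ⊤ := by
  have : Finite (G ⧸ hypercenter G) := Nat.finite_of_card_ne_zero hZ
  set F : Subgroup G := closure (Set.range (Quotient.out : G ⧸ hypercenter G → G))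
  have hF : F.FG := (fg_iff _).2 ⟨_, rfl, Set.finite_range _⟩
  have hFZ : F ⊔ hypercenter G = ⊤ := by
    refine eq_top_iff.2 fun g _ => ?_
    obtain ⟨z, hz⟩ := mk_out_eq_mul (hypercenter G) g
    rw [eq_mul_inv_of_mul_eq hz.symm]
    exact mul_mem_sup (subset_closure (Set.mem_range_self _)) (inv_mem z.2)
  obtain ⟨hfin, m, hm⟩ := finite_nilpotentResidual hZ hF
  set R := nilpotentResidual F
  have hRZ : R ≤ centralizer (hypercenter G : Set G) :=
    nilpotentResidual_le_centralizer_hypercenter hF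
  have hnormal : R.Normal := by
    rw [← normalizer_eq_top_iff, eq_top_iff, ← hFZ]
    refine sup_le (hm ▸ Subgroup.self_le_normalizer_lowerCentralSeries F m) ?_
    exact (le_centralizer_iff.1 hRZ).trans (centralizer_le_normalizer _)
  have hperfect : R ≤ ⁅R, ⊤⁆ := calc
    R ≤ F.lowerCentralSeries (m + 1) := iInf_le _ _
    _ = ⁅R, F⁆ := hm ▸ rfl
    _ ≤ ⁅R, ⊤⁆ := commutator_mono le_rfl le_top
  have hR : hypercenterOver R = ⊤ := by
    have hZR : hypercenter G ≤ hypercenterOver R :=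
      hypercenterOver_bot (G := G) ▸ hypercenterOver_mono bot_le
    refine hypercenterOver_eq_top_of_lowerCentralSeries_le (F := F) (n := m) ?_
      (hm ▸ le_hypercenterOver)
    exact top_le_iff.1 (hFZ.ge.trans (sup_le_sup_left hZR F))
  exact ⟨R, hnormal, hfin, card_le_residualBound hZ hRZ hperfect hR, hR⟩

end HypercentralByFinite

section Series

variable {G : Type u} [Group G]

theorem index_hypercenter_quotient_le {A F B : Subgroup G} [A.Normal] [F.Normal] [B.Normal]
    (hAF : A ≤ hypercenterOver F) (hAB : A.relIndex B ≠ 0) (hB : hypercenterOver B = ⊤) :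
    (hypercenter (G ⧸ F)).index ≠ 0 ∧
      (hypercenter (G ⧸ F)).index ≤ hypercenterBound (A.relIndex B) := by
  obtain ⟨hindex, hindex_le⟩ := index_hypercenterOver_le hAB hB
  have hdvd := index_dvd_of_le (hypercenterOver_le_hypercenterOver hAF)
  rw [← index_comap_of_surjective _ (mk'_surjective F)]
  exact ⟨ne_zero_of_dvd_ne_zero hindex hdvd,
    (Nat.le_of_dvd (Nat.pos_of_ne_zero hindex) hdvd).trans hindex_le⟩

theorem relIndex_comap_mk' {D F : Subgroup G} [F.Normal] (hDF : D ≤ F) (L : Subgroup (G ⧸ F)) :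
    D.relIndex (L.comap (mk' F)) = D.relIndex F * Nat.card L := by
  have hF : F.relIndex (L.comap (mk' F)) = Nat.card L := by
    simpa only [ker_mk', map_comap_eq_self_of_surjective (mk'_surjective F)] using
      relIndex_ker (K := L.comap (mk' F)) (mk' F)
  rw [← hF, relIndex_mul_relIndex D F _ hDF (le_comap_mk' F L)]

theorem exists_hypercenterOver_eq_top_of_factor {A F D B : Subgroup G} [A.Normal] [F.Normal]
    [B.Normal] (hDF : D ≤ F) (hD : D.relIndex F ≠ 0) (hAF : A ≤ hypercenterOver F)
    (hAB : A.relIndex B ≠ 0) (hB : hypercenterOver B = ⊤) :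
    ∃ L : Subgroup G, ∃ _ : L.Normal, D.relIndex L ≠ 0 ∧
      D.relIndex L ≤ D.relIndex F * residualBound (hypercenterBound (A.relIndex B)) ∧
      hypercenterOver L = ⊤ := by
  obtain ⟨hindex, hindex_le⟩ := index_hypercenter_quotient_le hAF hAB hB
  obtain ⟨L, hLn, hfin, hcard, hL⟩ := exists_finite_hypercenterOver_eq_top hindex
  refine ⟨L.comap (mk' F), inferInstance, ?_, ?_, ?_⟩
  · rw [relIndex_comap_mk' hDF]
    exact mul_ne_zero hD Nat.card_pos.ne'
  · rw [relIndex_comap_mk' hDF]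
    exact Nat.mul_le_mul_left _ (hcard.trans (residualBound_mono hindex_le))
  · have hcomap := comap_hypercenterOver_le (mk' F) (A := L)
    rwa [hL, comap_top, top_le_iff] at hcomap

/-- A bound for the order, modulo the `j`-th term of the series, of a normal subgroup with
hypercentral quotient, when the finite factors have order at most `t`. -/
def seriesBound (t : ℕ) : ℕ → ℕ
  | 0 => 1
  | j + 1 => t * residualBound (hypercenterBound (seriesBound t j))

theorem exists_hypercenterOver_eq_top_of_series {n : ℕ} {Gs : Fin (n + 1) → Subgroup G}
    {F : Fin n → Subgroup G} {t : ℕ} [∀ i, (Gs i).Normal] [∀ i, (F i).Normal] (htop : Gs 0 = ⊤)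
    (hle : ∀ i : Fin n, Gs i.succ ≤ F i) (hfin : ∀ i : Fin n, (Gs i.succ).relIndex (F i) ≠ 0)
    (ht : ∀ i : Fin n, (Gs i.succ).relIndex (F i) ≤ t)
    (hyp : ∀ i : Fin n, Gs i.castSucc ≤ hypercenterOver (F i)) (i : Fin (n + 1)) :
    ∃ L : Subgroup G, ∃ _ : L.Normal, (Gs i).relIndex L ≠ 0 ∧
      (Gs i).relIndex L ≤ seriesBound t i ∧ hypercenterOver L = ⊤ := by
  induction i using Fin.induction with
  | zero =>
    rw [htop]
    exact ⟨⊤, inferInstance, (relIndex_self ⊤).trans_ne one_ne_zero, (relIndex_self ⊤).le,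
      top_le_iff.1 (le_hypercenterOver (A := ⊤))⟩
  | succ i ih =>
    obtain ⟨B, hBn, hB0, hBt, hB⟩ := ih
    obtain ⟨L, hLn, hL0, hLt, hL⟩ :=
      exists_hypercenterOver_eq_top_of_factor (hle i) (hfin i) (hyp i) hB0 hB
    exact ⟨L, hLn, hL0, hLt.trans <| Nat.mul_le_mul (ht i) <| residualBound_mono <|
      hypercenterBound_mono hBt, hL⟩

/-- The largest of the bounds `seriesBound t j` for series of length `j ≤ t`; since all the finite
factors are nontrivial, the product `t` of their orders bounds the length. -/
def totalBound (t : ℕ) : ℕ := (Finset.range (t + 1)).sup (seriesBound t)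

theorem seriesBound_le_totalBound {n t : ℕ} (h : n ≤ t) : seriesBound t n ≤ totalBound t :=
  Finset.le_sup (Finset.mem_range_succ_iff.2 h)

theorem card_le_prod {ι : Type*} {s : Finset ι} {t : ι → ℕ} (ht : ∀ i ∈ s, 1 < t i) :
    s.card ≤ ∏ i ∈ s, t i :=
  Nat.lt_two_pow_self.le.trans (Finset.pow_card_le_prod s t 2 ht)

end Series

end Hypercentral

/-- `Gs i` is `G_i` for `0 ≤ i ≤ n`, and `F i`, `t i` with `i : Fin n` are `F_{i+1}`, `t_{i+1}`. -/
theorem mainTheorem3 :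
    ∃ f g : ℕ → ℕ, ∀ (G : Type u) [Group G] (n : ℕ)
      (Gs : Fin (n + 1) → Subgroup G) (F : Fin n → Subgroup G) (t : Fin n → ℕ)
      [∀ i, (Gs i).Normal] [∀ i, (F i).Normal],
      Gs 0 = ⊤ → Gs (Fin.last n) = ⊥ →
      (∀ i : Fin n, F i ≤ Gs i.castSucc) →
      (∀ i : Fin n, Gs i.succ ≤ F i) →
      (∀ i : Fin n, (Gs i.succ).relIndex (F i) = t i ∧ 1 < t i) →
      (∀ i : Fin n, (Gs i.castSucc).map (QuotientGroup.mk' (F i)) ≤ hypercenter (G ⧸ F i)) →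
      (∃ (L : Subgroup G) (_ : L.Normal),
        Finite L ∧ Nat.card L ≤ f (∏ i, t i) ∧ IsHypercentral (G ⧸ L)) ∧
      (hypercenter G).FiniteIndex ∧ (hypercenter G).index ≤ g (∏ i, t i) := by
  refine ⟨Hypercentral.totalBound, Hypercentral.hypercenterBound ∘ Hypercentral.totalBound, ?_⟩
  intro G _ n Gs F t _ _ htop hbot _ hle ht hyp
  have hpos (i : Fin n) : 0 < t i := zero_lt_one.trans (ht i).2
  have ht_le (i : Fin n) : t i ≤ ∏ i, t i :=
    Finset.single_le_prod' (fun i _ => hpos i) (Finset.mem_univ i)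
  have hn : n ≤ ∏ i, t i := by
    simpa only [Finset.card_fin] using
      Hypercentral.card_le_prod (s := Finset.univ) fun i _ => (ht i).2
  obtain ⟨L, hLn, hL0, hLb, hL⟩ := Hypercentral.exists_hypercenterOver_eq_top_of_series htop hle
    (fun i => (ht i).1.trans_ne (hpos i).ne') (fun i => (ht i).1.trans_le (ht_le i))
    (fun i => Subgroup.map_le_iff_le_comap.1 (hyp i)) (Fin.last n)
  rw [hbot, Subgroup.relIndex_bot_left] at hL0 hLb
  have hLfin : Finite L := Nat.finite_of_card_ne_zero hL0
  have hLt := hLb.trans (Hypercentral.seriesBound_le_totalBound hn)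
  obtain ⟨hindex, hindex_le⟩ := Hypercentral.index_hypercenter_le L hL
  exact ⟨⟨L, hLn, hLfin, hLt, Hypercentral.hypercenterOver_eq_top_iff.1 hL⟩, ⟨hindex⟩,
    hindex_le.trans (Hypercentral.hypercenterBound_mono hLt)⟩
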